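/- An MV-algebra is a structure $(A,\oplus,{}^*,0)$ such that $(A,\oplus,0)$ is a commutative monoid and, for all $x,y\in A$, $x^{**}=x$, $0^*\oplus x=0^*$ and $(x^*\oplus y)^*\oplus y=(y^*\oplus x)^*\oplus x$; put $x\odot y=(x^*\oplus y^*)^*$. The interval $[0,1]\subseteq\mathbb R$ is an MV-algebra with $r\oplus q=\min(1,r+q)$ and $r^*=1-r$. A Riesz MV-algebra is an MV-algebra $R$ with a map $\cdot:[0,1]\times R\to R$ such that, for all $r,q\in[0,1]$ and $x,y\in R$, $$r\cdot(x\odot y^*)=(r\cdot x)\odot(r\cdot y)^*,\quad (r\odot q^*)\cdot x=(r\cdot x)\odot(q\cdot x)^*,\quad r\cdot(q\cdot x)=(rq)\cdot x,\quad 1\cdot x=x,$$ where $rq$ is the product of real numbers. Morphisms of Riesz MV-algebras are the maps preserving $\oplus$, ${}^*$, $0$ and the scalar multiplication; they form the category $\mathbb{RMV}$. A unital Riesz space is a pair $(V,u)$ of a Riesz space (real vector lattice) $V$ and a strong unit $u$ of $V$, i.e. $u\ge 0$ and for every $x\in V$ there is $n\in\mathbb N$ with $x\le nu$. Morphisms $(V,u)\to(V',u')$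 are the linear lattice homomorphisms $f$ with $f(u)=u'$; they form the category $\mathbb{RS}_u$. The interval $[0,u]_V=\{x\in V\mid 0\le x\le u\}$, with $x\oplus y=(x+y)\wedge u$, $x^*=u-x$ and the scalar multiplication of $V$ restricted to scalars in $[0,1]$, is a Riesz MV-algebra. **Theorem.** The functor $\Gamma_R:\mathbb{RS}_u\to\mathbb{RMV}$ given by $\Gamma_R(V,u)=[0,u]_V$ and $\Gamma_R(f)=f|_{[0,u]}$ is an equivalence of categories. In particular, for every Riesz MV-algebra $R$ there is a unital Riesz space $(V,u)$ such that $R$ is isomorphic to $[0,u]_V$ as a Riesz MV-algebra. -/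

import Mathlib

open CategoryTheory

universe w

noncomputable section

namespace RieszMV

/-- MV-algebras `(A, ⊕, *, 0)`. -/
class MVAlgebra (A : Type*) where
  /-- truncated sum -/
  oplus : A → A → A
  /-- the involution -/
  star : A → A
  /-- the neutral element -/
  zero : A
  oplus_assoc : ∀ x y z : A, oplus (oplus x y) z = oplus x (oplus y z)
  oplus_comm : ∀ x y : A, oplus x y = oplus y x
  oplus_zero : ∀ x : A, oplus x zero = x
  star_star : ∀ x : A, star (star x) = x
  star_zero_oplus : ∀ x : A, oplus (star zero) x = star zero
  mv_comm : ∀ x y : A, oplus (star (oplus (star x) y)) y = oplus (star (oplus (star y) x)) x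

infixl:65 " ⊞ " => MVAlgebra.oplus
postfix:max "∗" => MVAlgebra.star

/-- The product `x ⊙ y = (x* ⊕ y*)*` of an MV-algebra. -/
def odot {A : Type*} [MVAlgebra A] (x y : A) : A := (x∗ ⊞ y∗)∗

infixl:70 " ⊡ " => odot

section Interval

variable {V : Type*} [AddCommGroup V] [Lattice V] [IsOrderedAddMonoid V]

/-- The interval `[0,u]` of an abelian lattice-ordered group, with `x ⊕ y = (x + y) ∧ u` and
`x* = u - x`, as an MV-algebra. -/
@[reducible] def intervalMV (u : V) (hu : 0 ≤ u) : MVAlgebra (Set.Icc (0 : V) u) where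
  oplus x y := ⟨(x.1 + y.1) ⊓ u, le_inf (add_nonneg x.2.1 y.2.1) hu, inf_le_right⟩
  star x := ⟨u - x.1, sub_nonneg.2 x.2.2, sub_le_self _ x.2.1⟩
  zero := ⟨0, le_rfl, hu⟩
  oplus_assoc := by
    rintro ⟨x, hx0, hx⟩ ⟨y, hy0, hy⟩ ⟨z, hz0, hz⟩
    apply Subtype.ext
    change ((x + y) ⊓ u + z) ⊓ u = (x + (y + z) ⊓ u) ⊓ u
    rw [inf_add, add_inf, inf_assoc, inf_assoc, inf_eq_right.2 (le_add_of_nonneg_right hz0),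
      inf_eq_right.2 (le_add_of_nonneg_left hx0), add_assoc]
  oplus_comm := by
    rintro ⟨x, hx0, hx⟩ ⟨y, hy0, hy⟩
    apply Subtype.ext
    change (x + y) ⊓ u = (y + x) ⊓ u
    rw [add_comm]
  oplus_zero := by
    rintro ⟨x, hx0, hx⟩
    apply Subtype.ext
    change (x + 0) ⊓ u = x
    rw [add_zero, inf_eq_left.2 hx]
  star_star := by
    rintro ⟨x, hx0, hx⟩
    apply Subtype.ext
    change u - (u - x) = x
    abel
  star_zero_oplus := by
    rintro ⟨x, hx0, hx⟩
    apply Subtype.ext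
    change (u - 0 + x) ⊓ u = u - 0
    rw [sub_zero, inf_eq_right.2 (le_add_of_nonneg_right hx0)]
  mv_comm := by
    have key : ∀ x y : V, x ≤ u → y ≤ u →
        (u - ((u - x + y) ⊓ u) + y) ⊓ u = x ⊔ y := by
      intro x y hx hy
      rw [sub_inf, sub_self, sup_add, zero_add]
      have : u - (u - x + y) + y = x := by abel
      rw [this, inf_eq_left.2 (sup_le hx hy)]
    rintro ⟨x, hx0, hx⟩ ⟨y, hy0, hy⟩
    apply Subtype.ext
    change (u - ((u - x + y) ⊓ u) + y) ⊓ u = (u - ((u - y + x) ⊓ u) + x) ⊓ u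
    rw [key x y hx hy, key y x hy hx, sup_comm]

/-- In `[0,u]` one has `x ⊙ y* = (x - y) ∨ 0`. -/
theorem interval_odot_star (u : V) (hu : 0 ≤ u) (x y : Set.Icc (0 : V) u) :
    (letI := intervalMV u hu; (x ⊡ y∗ : Set.Icc (0 : V) u).1) = (x.1 - y.1) ⊔ 0 := by
  obtain ⟨x, hx0, hx⟩ := x
  obtain ⟨y, hy0, hy⟩ := y
  change u - ((u - x) + (u - (u - y))) ⊓ u = (x - y) ⊔ 0
  rw [sub_inf, sub_self]
  congr 1
  abel

end Interval

/-- The standard MV-algebra `[0,1]`, with `x ⊕ y = min (x + y) 1` and `x* = 1 - x`. -/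
instance standardMV : MVAlgebra unitInterval := intervalMV (1 : ℝ) zero_le_one

/-- Riesz MV-algebras: MV-algebras with a scalar multiplication by elements of `[0,1]`. In
`rmv2` the operations `⊙` and `*` on scalars are those of the standard MV-algebra, in `rmv3` the
product `r * q` is the product of real numbers. -/
class RieszMVAlgebra (R : Type*) extends MVAlgebra R, SMul unitInterval R where
  rmv1 : ∀ (r : unitInterval) (x y : R), r • (x ⊡ y∗) = (r • x) ⊡ (r • y)∗
  rmv2 : ∀ (r q : unitInterval) (x : R), (r ⊡ q∗) • x = (r • x) ⊡ (q • x)∗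
  rmv3 : ∀ (r q : unitInterval) (x : R), r • (q • x) = (r * q) • x
  rmv4 : ∀ x : R, (1 : unitInterval) • x = x

/-- Morphisms of Riesz MV-algebras: maps preserving all the operations. -/
@[ext] structure RieszMVHom (R S : Type*) [RieszMVAlgebra R] [RieszMVAlgebra S] where
  /-- the underlying map -/
  toFun : R → S
  map_zero : toFun MVAlgebra.zero = MVAlgebra.zero
  map_oplus : ∀ x y : R, toFun (x ⊞ y) = toFun x ⊞ toFun y
  map_star : ∀ x : R, toFun x∗ = (toFun x)∗
  map_smul : ∀ (r : unitInterval) (x : R), toFun (r • x) = r • toFun x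

/-- The objects of the category of Riesz MV-algebras. -/
structure RieszMVCat where
  /-- the underlying set -/
  carrier : Type w
  [str : RieszMVAlgebra carrier]

attribute [instance] RieszMVCat.str

instance : CoeSort RieszMVCat.{w} (Type w) := ⟨RieszMVCat.carrier⟩

instance : Category RieszMVCat.{w} where
  Hom R S := RieszMVHom R S
  id R := ⟨fun x => x, rfl, fun _ _ => rfl, fun _ => rfl, fun _ _ => rfl⟩
  comp f g := ⟨fun x => g.toFun (f.toFun x), by rw [f.map_zero, g.map_zero],
    fun x y => by rw [f.map_oplus, g.map_oplus], fun x => by rw [f.map_star, g.map_star],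
    fun r x => by rw [f.map_smul, g.map_smul]⟩

/-- A strong unit of an abelian lattice-ordered group. -/
def IsStrongUnit {V : Type*} [AddCommGroup V] [Lattice V] (u : V) : Prop :=
  0 ≤ u ∧ ∀ x : V, ∃ n : ℕ, x ≤ n • u

/-- Unital Riesz spaces `(V,u)`: real vector lattices with a distinguished strong unit. -/
structure UnitalRieszSpace where
  /-- the underlying set -/
  carrier : Type w
  [addCommGroup : AddCommGroup carrier]
  [lattice : Lattice carrier]
  [isOrderedAddMonoid : IsOrderedAddMonoid carrier]
  [module : Module ℝ carrier]
  [posSMulMono : PosSMulMono ℝ carrier]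
  /-- the strong unit -/
  unit : carrier
  isStrongUnit : IsStrongUnit unit

attribute [instance] UnitalRieszSpace.addCommGroup UnitalRieszSpace.lattice
  UnitalRieszSpace.isOrderedAddMonoid UnitalRieszSpace.module UnitalRieszSpace.posSMulMono

instance : CoeSort UnitalRieszSpace.{w} (Type w) := ⟨UnitalRieszSpace.carrier⟩

/-- Morphisms of unital Riesz spaces: linear lattice homomorphisms preserving the unit. -/
@[ext] structure UnitalRieszHom (V W : UnitalRieszSpace.{w}) extends V →ₗ[ℝ] W where
  map_sup : ∀ x y : V, toFun (x ⊔ y) = toFun x ⊔ toFun y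
  map_inf : ∀ x y : V, toFun (x ⊓ y) = toFun x ⊓ toFun y
  map_unit : toFun V.unit = W.unit

instance : Category UnitalRieszSpace.{w} where
  Hom V W := UnitalRieszHom V W
  id V := ⟨LinearMap.id, fun _ _ => rfl, fun _ _ => rfl, rfl⟩
  comp f g := ⟨g.toLinearMap.comp f.toLinearMap,
    fun x y => (congrArg g.toFun (f.map_sup x y)).trans (g.map_sup _ _),
    fun x y => (congrArg g.toFun (f.map_inf x y)).trans (g.map_inf _ _),
    (congrArg g.toFun f.map_unit).trans g.map_unit⟩

section RieszInterval

variable {V : Type*} [AddCommGroup V] [Lattice V] [IsOrderedAddMonoid V] [Module ℝ V]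
  [PosSMulMono ℝ V]

/-- In a Riesz space, `r (x ∨ 0) = (r x) ∨ 0` for `r ≥ 0`. -/
theorem smul_sup_zero {r : ℝ} (hr : 0 ≤ r) (x : V) : r • (x ⊔ 0) = (r • x) ⊔ 0 := by
  rcases hr.eq_or_lt with rfl | hr
  · simp
  · have h : r • (x ⊔ 0) = (r • x) ⊔ (r • (0 : V)) := (OrderIso.smulRight hr).map_sup x (0 : V)
    rwa [smul_zero] at h

/-- The interval `[0,u]` of a Riesz space as a Riesz MV-algebra, with the scalar multiplication
of the Riesz space. -/
@[reducible] def intervalRieszMV (u : V) (hu : 0 ≤ u) : RieszMVAlgebra (Set.Icc (0 : V) u) where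
  toMVAlgebra := intervalMV u hu
  smul r x := ⟨(r : ℝ) • x.1, smul_nonneg r.2.1 x.2.1, by
    have h0 : (0 : V) ≤ (1 - (r : ℝ)) • x.1 := smul_nonneg (sub_nonneg.2 r.2.2) x.2.1
    rw [sub_smul, one_smul, sub_nonneg] at h0
    exact h0.trans x.2.2⟩
  rmv1 := by
    intro r x y
    apply Subtype.ext
    rw [interval_odot_star u hu]
    change (r : ℝ) • (_ : V) = ((r : ℝ) • x.1 - (r : ℝ) • y.1) ⊔ 0
    rw [interval_odot_star u hu, smul_sup_zero r.2.1, smul_sub]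
  rmv2 := by
    intro r q x
    apply Subtype.ext
    rw [interval_odot_star u hu]
    change (((r ⊡ q∗ : unitInterval) : ℝ)) • x.1 = ((r : ℝ) • x.1 - (q : ℝ) • x.1) ⊔ 0
    have h : ((r ⊡ q∗ : unitInterval) : ℝ) = ((r : ℝ) - q) ⊔ 0 :=
      interval_odot_star (1 : ℝ) zero_le_one r q
    rw [h, ← sub_smul]
    rcases le_total ((r : ℝ) - q) 0 with h | h
    · have h0 : (0 : V) ≤ (-((r : ℝ) - q)) • x.1 := smul_nonneg (neg_nonneg.2 h) x.2.1
      rw [neg_smul, neg_nonneg] at h0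
      rw [sup_eq_right.2 h, sup_eq_right.2 h0, zero_smul]
    · rw [sup_eq_left.2 h, sup_eq_left.2 (smul_nonneg h x.2.1)]
  rmv3 := by
    intro r q x
    apply Subtype.ext
    change (r : ℝ) • (q : ℝ) • x.1 = ((r * q : unitInterval) : ℝ) • x.1
    rw [smul_smul]
    rfl
  rmv4 := by
    intro x
    apply Subtype.ext
    change ((1 : unitInterval) : ℝ) • x.1 = x.1
    simp

end RieszInterval

/-- A morphism of unital Riesz spaces maps `[0,u]` to `[0,u']`. -/
theorem UnitalRieszHom.mem_Icc {V W : UnitalRieszSpace.{w}} (f : UnitalRieszHom V W) {x : V}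
    (hx : x ∈ Set.Icc (0 : V) V.unit) : f.toFun x ∈ Set.Icc (0 : W) W.unit := by
  have mono : ∀ a b : V, a ≤ b → f.toFun a ≤ f.toFun b := by
    intro a b hab
    have h := f.map_sup a b
    rw [sup_eq_right.2 hab] at h
    rw [h]
    exact le_sup_left
  constructor
  · have h := mono _ _ hx.1
    rwa [show f.toFun 0 = 0 from f.toLinearMap.map_zero] at h
  · have h := mono _ _ hx.2
    rwa [f.map_unit] at h

/-- The functor `Γ_R`: it sends `(V,u)` to the Riesz MV-algebra `[0,u]_V` and a morphism to its
restriction to `[0,u]`. -/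
def GammaR : UnitalRieszSpace.{w} ⥤ RieszMVCat.{w} where
  obj V :=
    { carrier := Set.Icc (0 : V) V.unit
      str := intervalRieszMV V.unit V.isStrongUnit.1 }
  map {V W} f :=
    letI := intervalRieszMV V.unit V.isStrongUnit.1
    letI := intervalRieszMV W.unit W.isStrongUnit.1
    { toFun := fun x => ⟨f.toFun x.1, f.mem_Icc x.2⟩
      map_zero := Subtype.ext f.toLinearMap.map_zero
      map_oplus := fun x y => Subtype.ext <| by
        change f.toFun ((x.1 + y.1) ⊓ V.unit) = (f.toFun x.1 + f.toFun y.1) ⊓ W.unit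
        rw [f.map_inf, f.map_unit]
        exact congrArg (· ⊓ W.unit) (f.toLinearMap.map_add _ _)
      map_star := fun x => Subtype.ext <| by
        change f.toFun (V.unit - x.1) = W.unit - f.toFun x.1
        rw [← f.map_unit]
        exact f.toLinearMap.map_sub _ _
      map_smul := fun r x => Subtype.ext (f.toLinearMap.map_smul (r : ℝ) x.1) }
  map_id _ := rfl
  map_comp _ _ := rfl

end RieszMV

end

/-! The scalars make a Riesz MV-algebra `R` behave like the unit interval of a vector lattice: `sm p
x ⊕ₘ sm q y` is never truncated when `p + q ≤ 1` (`sm_le_sm_star`), so midpoints and homotheties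
centred at the middle point `1/2` exist inside `R`. Multiplication by `r > 0` is injective
(`sm_injective`), so nothing is lost by shrinking.

Essential surjectivity: the enveloping space consists of formal quotients `(x - 1/2) / e` with `x`
in `R` and `0 < e ≤ 1`. Two vectors can be put over a common denominator by contracting, so each
vector lattice axiom becomes an identity between points of `R`. A sum is twice a midpoint; a real
multiple is a homothety followed by a dilation. The interval from zero to the unit is exactly `R`:
`of_oplus` recovers the truncated sum, and `exists_of_eq` recovers every vector of the interval
because elements below `2⁻ⁿ` are divisible by `2⁻ⁿ` (`exists_sm_half_pow_eq`).

Full faithfulness: since the unit is strong, every `v` lies in some `[-tu, tu]`, which an affine map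
carries onto `[0, u]`. A linear map fixing the units is thus determined on `[0, u]`. Conversely, a
morphism `h` of intervals is additive on sums that stay below `u` (`extendZero_add`), which makes
the rescaled values of `h` independent of `t` (`extendAt_eq_of_le`) and linear. -/

noncomputable section

namespace RieszMV

/-! ### MV-algebras: natural lattice order and truncated difference. -/

section MV

variable {A : Type*} [MVAlgebra A]

infixl:65 " ⊕ₘ " => MVAlgebra.oplus

/-- The top element `0*` of an MV-algebra. -/
def one : A := (MVAlgebra.zero : A)∗

/-- The truncated difference `x ⊖ y = x ⊙ y*` of an MV-algebra. -/
def ominus (x y : A) : A := x ⊡ y∗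

infixl:65 " ⊖ₘ " => ominus

@[simp] theorem star_star (x : A) : x∗∗ = x := MVAlgebra.star_star x

instance : Std.Associative (MVAlgebra.oplus : A → A → A) := ⟨MVAlgebra.oplus_assoc⟩

instance : Std.Commutative (MVAlgebra.oplus : A → A → A) := ⟨MVAlgebra.oplus_comm⟩

theorem star_inj {x y : A} (h : x∗ = y∗) : x = y := by
  rw [← star_star x, h, star_star]

@[simp] theorem oplus_zero (x : A) : x ⊕ₘ MVAlgebra.zero = x := MVAlgebra.oplus_zero x

@[simp] theorem zero_oplus (x : A) : MVAlgebra.zero ⊕ₘ x = x := by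
  rw [MVAlgebra.oplus_comm, oplus_zero]

@[simp] theorem star_zero : (MVAlgebra.zero : A)∗ = one := rfl

@[simp] theorem star_one : (one : A)∗ = MVAlgebra.zero := star_star _

@[simp] theorem one_oplus (x : A) : one ⊕ₘ x = one := MVAlgebra.star_zero_oplus x

@[simp] theorem oplus_one (x : A) : x ⊕ₘ one = one := by
  rw [MVAlgebra.oplus_comm, one_oplus]

@[simp] theorem star_oplus_self (x : A) : x∗ ⊕ₘ x = one := by
  -- At `1` and `x` the right side of the axiom collapses to `1`.
  have h := MVAlgebra.mv_comm one x
  simpa using h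

@[simp] theorem oplus_star_self (x : A) : x ⊕ₘ x∗ = one := by
  rw [MVAlgebra.oplus_comm, star_oplus_self]

theorem ominus_def (x y : A) : x ⊖ₘ y = (x∗ ⊕ₘ y)∗ := by
  rw [ominus, odot, star_star]

@[simp] theorem one_ominus (x : A) : one ⊖ₘ x = x∗ := by
  simp [ominus_def]

@[simp] theorem ominus_self (x : A) : x ⊖ₘ x = MVAlgebra.zero := by
  simp [ominus_def]

@[simp] theorem ominus_zero (x : A) : x ⊖ₘ MVAlgebra.zero = x := by
  simp [ominus_def]

theorem star_oplus (x y : A) : (x ⊕ₘ y)∗ = x∗ ⊖ₘ y := by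
  simp only [ominus_def, star_star]

theorem ominus_oplus_comm (x y : A) : x ⊖ₘ y ⊕ₘ y = y ⊖ₘ x ⊕ₘ x := by
  simpa only [ominus_def] using MVAlgebra.mv_comm x y

/-- The natural order of an MV-algebra. -/
def mvLE (x y : A) : Prop := x∗ ⊕ₘ y = one

theorem mvLE_iff_exists {x y : A} : mvLE x y ↔ ∃ c, y = x ⊕ₘ c := by
  constructor
  · intro h
    refine ⟨y ⊖ₘ x, ?_⟩
    rw [MVAlgebra.oplus_comm, ominus_oplus_comm, ominus_def, h, star_one, zero_oplus]
  · rintro ⟨c, rfl⟩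
    rw [mvLE, ← MVAlgebra.oplus_assoc, star_oplus_self, one_oplus]

theorem ominus_oplus_of_mvLE {x y : A} (h : mvLE x y) : y ⊖ₘ x ⊕ₘ x = y := by
  rw [ominus_oplus_comm, ominus_def, h, star_one, zero_oplus]

theorem mvLE_trans {x y z : A} (h : mvLE x y) (h' : mvLE y z) : mvLE x z := by
  obtain ⟨c, rfl⟩ := mvLE_iff_exists.1 h
  obtain ⟨d, rfl⟩ := mvLE_iff_exists.1 h'
  exact mvLE_iff_exists.2 ⟨c ⊕ₘ d, MVAlgebra.oplus_assoc _ _ _⟩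

theorem mvLE_star {x y : A} (h : mvLE x y) : mvLE y∗ x∗ := by
  rw [mvLE, star_star, MVAlgebra.oplus_comm]
  exact h

theorem mvLE_oplus {x y : A} (h : mvLE x y) (z : A) : mvLE (x ⊕ₘ z) (y ⊕ₘ z) := by
  obtain ⟨c, rfl⟩ := mvLE_iff_exists.1 h
  exact mvLE_iff_exists.2 ⟨c, by ac_rfl⟩

theorem mvLE_ominus {x y : A} (h : mvLE x y) (z : A) : mvLE (x ⊖ₘ z) (y ⊖ₘ z) := by
  rw [ominus_def, ominus_def]
  exact mvLE_star (mvLE_oplus (mvLE_star h) z)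

theorem mvLE_ominus_oplus_right (x y : A) : mvLE y (x ⊖ₘ y ⊕ₘ y) :=
  mvLE_iff_exists.2 ⟨x ⊖ₘ y, MVAlgebra.oplus_comm _ _⟩

theorem mvLE_ominus_oplus_left (x y : A) : mvLE x (x ⊖ₘ y ⊕ₘ y) := by
  rw [ominus_oplus_comm]
  exact mvLE_ominus_oplus_right y x

theorem ominus_oplus_mvLE {x y z : A} (h : mvLE x z) (h' : mvLE y z) :
    mvLE (x ⊖ₘ y ⊕ₘ y) z := by
  have := mvLE_oplus (mvLE_ominus h y) y
  rwa [ominus_oplus_of_mvLE h'] at this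

/-- The natural lattice order of an MV-algebra. -/
@[reducible] def mvLattice (A : Type*) [MVAlgebra A] : Lattice A where
  le := mvLE
  le_refl := star_oplus_self
  le_trans _ _ _ := mvLE_trans
  le_antisymm x y h h' := by
    have := ominus_oplus_of_mvLE h
    rwa [ominus_oplus_comm, ominus_oplus_of_mvLE h'] at this
  sup x y := x ⊖ₘ y ⊕ₘ y
  le_sup_left := mvLE_ominus_oplus_left
  le_sup_right := mvLE_ominus_oplus_right
  sup_le _ _ _ := ominus_oplus_mvLE
  inf x y := (x∗ ⊖ₘ y∗ ⊕ₘ y∗)∗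
  inf_le_left x y := by
    simpa only [star_star] using mvLE_star (mvLE_ominus_oplus_left x∗ y∗)
  inf_le_right x y := by
    simpa only [star_star] using mvLE_star (mvLE_ominus_oplus_right x∗ y∗)
  le_inf x y z h h' := by
    simpa only [star_star] using mvLE_star (ominus_oplus_mvLE (mvLE_star h) (mvLE_star h'))

attribute [local instance] mvLattice

theorem mv_le_def {x y : A} : x ≤ y ↔ x∗ ⊕ₘ y = one := Iff.rfl

theorem mv_star_sup (x y : A) : (x ⊔ y)∗ = x∗ ⊓ y∗ := by
  change _ = (x∗∗ ⊖ₘ y∗∗ ⊕ₘ y∗∗)∗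
  simp only [star_star]
  rfl

/-- Truncated difference is the operation the scalar axioms respect, so this form shows that scalars
preserve meets. -/
theorem mv_inf_eq (x y : A) : x ⊓ y = x ⊖ₘ (x ⊖ₘ y) := by
  rw [inf_comm]
  change (y∗ ⊖ₘ x∗ ⊕ₘ x∗)∗ = _
  rw [ominus_def, ominus_def, ominus_def, star_star, MVAlgebra.oplus_comm y,
    MVAlgebra.oplus_comm x∗ (_)∗]

theorem mv_star_le_star {x y : A} (h : x ≤ y) : y∗ ≤ x∗ := mvLE_star h

theorem mv_le_star_comm {x y : A} (h : x ≤ y∗) : y ≤ x∗ := by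
  simpa using mv_star_le_star h

theorem mv_le_one (x : A) : x ≤ one := oplus_one _

theorem mv_zero_le (x : A) : MVAlgebra.zero ≤ x := one_oplus _

theorem oplus_le_oplus {x y z t : A} (h : x ≤ y) (h' : z ≤ t) : x ⊕ₘ z ≤ y ⊕ₘ t :=
  le_trans (mvLE_oplus h z) (by
    rw [MVAlgebra.oplus_comm y, MVAlgebra.oplus_comm y]; exact mvLE_oplus h' y)

/-- Residuation: both sides unfold to the same equation. As right adjoint, `⊕ₘ` then distributes
over meets. -/
theorem ominus_le_iff {x y z : A} : x ⊖ₘ y ≤ z ↔ x ≤ z ⊕ₘ y := by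
  rw [mv_le_def, mv_le_def, ominus_def, star_star, MVAlgebra.oplus_assoc,
    MVAlgebra.oplus_comm y]

theorem ominus_eq_zero_iff {x y : A} : x ⊖ₘ y = MVAlgebra.zero ↔ x ≤ y := by
  rw [← (mv_zero_le (x ⊖ₘ y)).ge_iff_eq', ominus_le_iff, zero_oplus]

theorem ominus_oplus_cancel {x y : A} (h : y ≤ x) : x ⊖ₘ y ⊕ₘ y = x := sup_eq_left.2 h

theorem oplus_ominus (x y : A) : x ⊕ₘ y ⊖ₘ y = x ⊓ y∗ := by
  change _ = (x∗ ⊖ₘ y∗∗ ⊕ₘ y∗∗)∗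
  simp only [ominus_def, star_star]

theorem oplus_ominus_cancel {x y : A} (h : x ≤ y∗) : x ⊕ₘ y ⊖ₘ y = x := by
  rw [oplus_ominus, inf_eq_left.2 h]

theorem inf_oplus (x y z : A) : (x ⊓ y) ⊕ₘ z = (x ⊕ₘ z) ⊓ (y ⊕ₘ z) :=
  GaloisConnection.u_inf (l := fun x => x ⊖ₘ z) (u := fun x => x ⊕ₘ z)
    (fun _ _ => ominus_le_iff)

theorem oplus_inf (x y z : A) : z ⊕ₘ (x ⊓ y) = (z ⊕ₘ x) ⊓ (z ⊕ₘ y) := by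
  simp only [MVAlgebra.oplus_comm z, inf_oplus]

theorem oplus_right_cancel {x y z : A} (hx : x ≤ z∗) (hy : y ≤ z∗) (h : x ⊕ₘ z = y ⊕ₘ z) :
    x = y := by
  rw [← oplus_ominus_cancel hx, h, oplus_ominus_cancel hy]

end MV

/-! ### Partial linearity and divisibility for scalars in `[0,1]`. -/

section Scalars

attribute [local instance] mvLattice

variable {R : Type*} [RieszMVAlgebra R]

/-- Scalar multiplication by real numbers, truncated to `[0,1]`. -/
def sm (r : ℝ) (x : R) : R := (Set.projIcc (0 : ℝ) 1 zero_le_one r : unitInterval) • x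

theorem sm_coe (r : unitInterval) (x : R) : sm (r : ℝ) x = r • x := by
  rw [sm, Set.projIcc_val]

theorem sm_ominus (r : ℝ) (x y : R) : sm r (x ⊖ₘ y) = sm r x ⊖ₘ sm r y :=
  RieszMVAlgebra.rmv1 _ x y

theorem sm_sub_sup {p q : ℝ} (hp : p ∈ Set.Icc (0 : ℝ) 1) (hq : q ∈ Set.Icc (0 : ℝ) 1) (x : R) :
    sm ((p - q) ⊔ 0) x = sm p x ⊖ₘ sm q x := by
  have h := RieszMVAlgebra.rmv2 (⟨p, hp⟩ : unitInterval) ⟨q, hq⟩ x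
  rw [← sm_coe, ← sm_coe, ← sm_coe] at h
  rw [show ((p - q) ⊔ 0 : ℝ) = ((⟨p, hp⟩ ⊡ (⟨q, hq⟩ : unitInterval)∗ : unitInterval) : ℝ) from
    (interval_odot_star (1 : ℝ) zero_le_one ⟨p, hp⟩ ⟨q, hq⟩).symm]
  exact h

@[simp] theorem sm_one (x : R) : sm 1 x = x := by
  have h := sm_coe (1 : unitInterval) x
  rw [RieszMVAlgebra.rmv4] at h
  exact h

theorem sm_sm {p q : ℝ} (hp : p ∈ Set.Icc (0 : ℝ) 1) (hq : q ∈ Set.Icc (0 : ℝ) 1) (x : R) :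
    sm p (sm q x) = sm (p * q) x := by
  have h := RieszMVAlgebra.rmv3 (⟨p, hp⟩ : unitInterval) ⟨q, hq⟩ x
  rw [← sm_coe, ← sm_coe, ← sm_coe] at h
  exact h

@[simp] theorem sm_zero_left (x : R) : sm 0 x = MVAlgebra.zero := by
  have h := sm_sub_sup (p := 0) (q := 0) (by simp) (by simp) x
  simpa using h

@[simp] theorem sm_zero (r : ℝ) : sm r (MVAlgebra.zero : R) = MVAlgebra.zero := by
  have h := sm_ominus r (MVAlgebra.zero : R) MVAlgebra.zero
  rwa [ominus_self, ominus_self] at h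

theorem sm_mono (r : ℝ) {x y : R} (h : x ≤ y) : sm r x ≤ sm r y := by
  rw [← ominus_eq_zero_iff] at h ⊢
  rw [← sm_ominus, h, sm_zero]

theorem sm_mono_left {p q : ℝ} (hp : 0 ≤ p) (hpq : p ≤ q) (hq : q ≤ 1) (x : R) :
    sm p x ≤ sm q x := by
  rw [← ominus_eq_zero_iff, ← sm_sub_sup ⟨hp, hpq.trans hq⟩ ⟨hp.trans hpq, hq⟩,
    sup_eq_right.2 (by linarith), sm_zero_left]

theorem sm_inf (r : ℝ) (x y : R) : sm r (x ⊓ y) = sm r x ⊓ sm r y := by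
  rw [mv_inf_eq, sm_ominus, sm_ominus, ← mv_inf_eq]

theorem sm_sub {p q : ℝ} (hq : 0 ≤ q) (hqp : q ≤ p) (hp : p ≤ 1) (x : R) :
    sm (p - q) x = sm p x ⊖ₘ sm q x := by
  rw [← sm_sub_sup ⟨hq.trans hqp, hp⟩ ⟨hq, hqp.trans hp⟩, sup_eq_left.2 (by linarith)]

theorem sm_add {p q : ℝ} (hp : 0 ≤ p) (hq : 0 ≤ q) (hpq : p + q ≤ 1) (x : R) :
    sm (p + q) x = sm p x ⊕ₘ sm q x := by
  have h := sm_sub hq (le_add_of_nonneg_left hp) hpq x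
  rw [add_sub_cancel_right] at h
  rw [h, ominus_oplus_cancel (sm_mono_left hq (by linarith) hpq x)]

theorem sm_one_star {p : ℝ} (hp : p ∈ Set.Icc (0 : ℝ) 1) :
    (sm p (one : R))∗ = sm (1 - p) one := by
  rw [sm_sub hp.1 hp.2 le_rfl, sm_one, one_ominus]

/-- Says that the sum of `p x` and `q y` does not overflow; this is the side condition for
cancellation and for `sm_oplus`. -/
theorem sm_le_sm_star {p q : ℝ} (hp : 0 ≤ p) (hq : 0 ≤ q) (hpq : p + q ≤ 1) (x y : R) :
    sm p x ≤ (sm q y)∗ :=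
  calc sm p x ≤ sm p one := sm_mono p (mv_le_one x)
    _ ≤ sm (1 - q) one := sm_mono_left hp (by linarith) (by linarith) _
    _ = (sm q one)∗ := (sm_one_star ⟨hq, by linarith⟩).symm
    _ ≤ (sm q y)∗ := mv_star_le_star (sm_mono q (mv_le_one y))

theorem sm_oplus (r : ℝ) {x y : R} (h : x ≤ y∗) : sm r (x ⊕ₘ y) = sm r x ⊕ₘ sm r y := by
  have h1 := sm_ominus r (x ⊕ₘ y) y
  rw [oplus_ominus_cancel h] at h1
  rw [h1, ominus_oplus_cancel (sm_mono r _)]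
  exact mvLE_iff_exists.2 ⟨x, MVAlgebra.oplus_comm _ _⟩

theorem sm_comb {r p q : ℝ} (hr : r ∈ Set.Icc (0 : ℝ) 1) (hp : 0 ≤ p) (hq : 0 ≤ q)
    (hpq : p + q ≤ 1) (x y : R) : sm r (sm p x ⊕ₘ sm q y) = sm (r * p) x ⊕ₘ sm (r * q) y := by
  rw [sm_oplus r (sm_le_sm_star hp hq hpq x y), sm_sm hr ⟨hp, by linarith⟩,
    sm_sm hr ⟨hq, by linarith⟩]

theorem sm_star_oplus {p : ℝ} (hp : p ∈ Set.Icc (0 : ℝ) 1) (x : R) :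
    (sm p x)∗ = sm p x∗ ⊕ₘ sm (1 - p) one := by
  rw [← one_ominus x, sm_ominus, ← sm_one_star hp]
  have h : sm p (one : R) ⊖ₘ sm p x = (sm p x)∗ ⊖ₘ (sm p one)∗ := by
    rw [ominus_def, ominus_def, star_star, MVAlgebra.oplus_comm]
  rw [h, ominus_oplus_cancel (mv_star_le_star (sm_mono p (mv_le_one x)))]

/-- The reflection `x ↦ 1 - x` is affine. The proof writes `1 - p x` as `p x∗ + q`, splits `q` as `q
y∗ + q y`, and subtracts `q y`. -/
theorem comb_star {p q : ℝ} (hp : 0 ≤ p) (hq : 0 ≤ q) (hpq : p + q = 1) (x y : R) :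
    (sm p x ⊕ₘ sm q y)∗ = sm p x∗ ⊕ₘ sm q y∗ := by
  obtain rfl : p = 1 - q := by linarith
  have hy : (sm q y)∗ = sm (1 - q) one ⊕ₘ sm q y∗ := by
    rw [sm_star_oplus ⟨hq, by linarith⟩, MVAlgebra.oplus_comm]
  have h1 : sm q (one : R) = sm q y∗ ⊕ₘ sm q y := by
    rw [← sm_oplus q le_rfl, star_oplus_self]
  rw [star_oplus, sm_star_oplus ⟨hp, by linarith⟩, sub_sub_cancel, h1, ← MVAlgebra.oplus_assoc,
    oplus_ominus_cancel]
  rw [hy]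
  exact oplus_le_oplus (sm_mono _ (mv_le_one _)) le_rfl

/-- If `r x = 0` then `(1 - r) x = x`, hence `(1 - r)ⁿ x = x` for all `n`. Once `(1 - r)ⁿ < r`, this
forces `x ≤ r x = 0`. -/
theorem eq_zero_of_sm_eq_zero {r : ℝ} (hr : 0 < r) (hr1 : r ≤ 1) {x : R}
    (h : sm r x = MVAlgebra.zero) : x = MVAlgebra.zero := by
  have hs : (1 - r) ∈ Set.Icc (0 : ℝ) 1 := ⟨by linarith, by linarith⟩
  have h1 : sm (1 - r) x = x := by rw [sm_sub hr.le hr1 le_rfl, h, sm_one, ominus_zero]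
  have h2 : ∀ n : ℕ, sm ((1 - r) ^ n) x = x := by
    intro n
    induction n with
    | zero => simp
    | succ n ih =>
      rw [pow_succ, ← sm_sm ⟨pow_nonneg hs.1 n, pow_le_one₀ hs.1 hs.2⟩ hs, h1, ih]
  obtain ⟨n, hn⟩ := exists_pow_lt_of_lt_one hr (by linarith : 1 - r < 1)
  have h3 := sm_mono_left (pow_nonneg hs.1 n) hn.le hr1 x
  rw [h2, h] at h3
  exact le_antisymm h3 (mv_zero_le x)

theorem le_of_sm_le_sm {r : ℝ} (hr : 0 < r) (hr1 : r ≤ 1) {x y : R} (h : sm r x ≤ sm r y) :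
    x ≤ y := by
  rw [← ominus_eq_zero_iff] at h ⊢
  rw [← sm_ominus] at h
  exact eq_zero_of_sm_eq_zero hr hr1 h

theorem sm_injective {r : ℝ} (hr : 0 < r) (hr1 : r ≤ 1) :
    Function.Injective (sm r : R → R) := fun _ _ h =>
  le_antisymm (le_of_sm_le_sm hr hr1 h.le) (le_of_sm_le_sm hr hr1 h.ge)

/-- Induction by doubling: an element below `2⁻⁽ⁿ⁺¹⁾` is at most `1/2`, so `z ⊕ₘ z` is not
truncated, lies below `2⁻ⁿ`, and halves back to `z`. -/
theorem exists_sm_half_pow_eq (n : ℕ) {z : R} (h : z ≤ sm ((1 / 2) ^ n) one) :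
    ∃ x : R, sm ((1 / 2) ^ n) x = z := by
  induction n generalizing z with
  | zero => exact ⟨z, by simp⟩
  | succ n ih =>
    have h0 : (0 : ℝ) ≤ (1 / 2) ^ n := by positivity
    have h1 : ((1 : ℝ) / 2) ^ n ≤ 1 := pow_le_one₀ (by norm_num) (by norm_num)
    have hz : z ≤ z∗ := by
      refine (h.trans ?_).trans (mv_star_le_star h)
      rw [pow_succ]
      exact sm_le_sm_star (by linarith) (by linarith) (by linarith) _ _
    have hzz : z ⊕ₘ z ≤ sm ((1 / 2) ^ n) one := by
      refine (oplus_le_oplus h h).trans (le_of_eq ?_)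
      rw [pow_succ, ← sm_add (by linarith) (by linarith) (by linarith)]
      congr 1
      ring
    obtain ⟨x, hx⟩ := ih hzz
    refine ⟨x, ?_⟩
    rw [pow_succ', ← sm_sm ⟨by norm_num, by norm_num⟩ ⟨h0, h1⟩, hx, sm_oplus _ hz,
      ← sm_add (by norm_num) (by norm_num) (by norm_num)]
    norm_num

/-- Replacing `y` by `y ⊓ x∗` leaves `x ⊕ₘ y` unchanged and removes the overflow, so `sm_oplus`
applies. -/
theorem sm_oplus_eq_inf (r : ℝ) (x y : R) :
    sm r (x ⊕ₘ y) = (sm r x ⊕ₘ sm r y) ⊓ sm r one := by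
  have h : x ⊕ₘ y = x ⊕ₘ (y ⊓ x∗) := by
    rw [oplus_inf, oplus_star_self, inf_eq_left.2 (mv_le_one _)]
  rw [h, sm_oplus r (mv_le_star_comm inf_le_right), sm_inf, oplus_inf,
    ← sm_oplus r (star_star x).ge, oplus_star_self]

end Scalars

/-! ### Homotheties about the middle point, and midpoints. -/

section Contract

attribute [local instance] mvLattice

variable {R : Type*} [RieszMVAlgebra R]

/-- The homothety of ratio `r ∈ [-1,1]` of a Riesz MV-algebra centred at the midpoint of `0` and
`1`. -/
def contract (r : ℝ) (x : R) : R := sm ((1 + r) / 2) x ⊕ₘ sm ((1 - r) / 2) x∗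

/-- The midpoint of `x` and `y`. -/
def avg (x y : R) : R := sm (1 / 2) x ⊕ₘ sm (1 / 2) y

theorem contract_star {r : ℝ} (hr : r ∈ Set.Icc (-1 : ℝ) 1) (x : R) :
    contract r x∗ = (contract r x)∗ := by
  rw [contract, contract, comb_star (by linarith [hr.1]) (by linarith [hr.2]) (by ring)]

theorem contract_contract {r s : ℝ} (hr : r ∈ Set.Icc (-1 : ℝ) 1) (hs : s ∈ Set.Icc (-1 : ℝ) 1)
    (x : R) : contract r (contract s x) = contract (r * s) x := by
  obtain ⟨hr1, hr2⟩ := hr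
  obtain ⟨hs1, hs2⟩ := hs
  -- Total weights of `x` and of `x∗` in the composite of the two homotheties.
  have e1 : (1 + r * s) / 2 =
    (1 + r) / 2 * ((1 + s) / 2) + (1 - r) / 2 * ((1 - s) / 2) := by ring
  have e2 : (1 - r * s) / 2 =
    (1 + r) / 2 * ((1 - s) / 2) + (1 - r) / 2 * ((1 + s) / 2) := by ring
  have p1 : 0 ≤ (1 + r) / 2 := by linarith
  have p2 : 0 ≤ (1 - r) / 2 := by linarith
  have p3 : 0 ≤ (1 + s) / 2 := by linarith
  have p4 : 0 ≤ (1 - s) / 2 := by linarith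
  rw [contract, ← contract_star ⟨hs1, hs2⟩]
  simp only [contract]
  rw [sm_comb ⟨p1, by linarith⟩ p3 p4 (by linarith), sm_comb ⟨p2, by linarith⟩ p3 p4 (by linarith),
    e1, e2, sm_add (by positivity) (by positivity) (by nlinarith),
    sm_add (by positivity) (by positivity) (by nlinarith), star_star]
  ac_rfl

/-- Equal weights `(1 - r) / 2` of `x` and `x∗` merge into a constant, leaving an expression
monotone in `x`. -/
theorem contract_of_nonneg {r : ℝ} (hr : 0 ≤ r) (hr1 : r ≤ 1) (x : R) :
    contract r x = sm r x ⊕ₘ sm ((1 - r) / 2) one := by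
  rw [contract, show (1 + r) / 2 = r + (1 - r) / 2 by ring,
    sm_add hr (by linarith) (by linarith), MVAlgebra.oplus_assoc,
    ← sm_oplus _ (star_star x).ge, oplus_star_self]

@[simp] theorem contract_one (x : R) : contract 1 x = x := by
  simp [contract]

theorem contract_mid {r : ℝ} (hr : r ∈ Set.Icc (-1 : ℝ) 1) :
    contract r (sm (1 / 2) one : R) = sm (1 / 2) one := by
  have h : (sm (1 / 2) one : R)∗ = sm (1 / 2) one := by
    rw [sm_one_star ⟨by norm_num, by norm_num⟩]
    norm_num
  rw [contract, h, ← sm_add (by linarith [hr.1]) (by linarith [hr.2]) (by linarith)]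
  rw [show (1 + r) / 2 + (1 - r) / 2 = 1 by ring, sm_one]

theorem contract_mono {r : ℝ} (hr : 0 ≤ r) (hr1 : r ≤ 1) {x y : R} (h : x ≤ y) :
    contract r x ≤ contract r y := by
  rw [contract_of_nonneg hr hr1, contract_of_nonneg hr hr1]
  exact oplus_le_oplus (sm_mono r h) le_rfl

theorem contract_injective {r : ℝ} (hr : 0 < r) (hr1 : r ≤ 1) :
    Function.Injective (contract r : R → R) := by
  intro x y h
  rw [contract_of_nonneg hr.le hr1, contract_of_nonneg hr.le hr1] at h
  exact sm_injective hr hr1 (oplus_right_cancel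
    (sm_le_sm_star hr.le (by linarith) (by linarith) _ _)
    (sm_le_sm_star hr.le (by linarith) (by linarith) _ _) h)

theorem contract_inf {r : ℝ} (hr : 0 ≤ r) (hr1 : r ≤ 1) (x y : R) :
    contract r (x ⊓ y) = contract r x ⊓ contract r y := by
  simp only [contract_of_nonneg hr hr1, sm_inf, inf_oplus]

theorem contract_sup {r : ℝ} (hr : 0 ≤ r) (hr1 : r ≤ 1) (x y : R) :
    contract r (x ⊔ y) = contract r x ⊔ contract r y := by
  have hr' : r ∈ Set.Icc (-1 : ℝ) 1 := ⟨by linarith, hr1⟩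
  apply star_inj
  rw [mv_star_sup, ← contract_star hr', ← contract_star hr', ← contract_star hr', mv_star_sup,
    contract_inf hr hr1]

theorem contract_avg {r : ℝ} (hr : r ∈ Set.Icc (-1 : ℝ) 1) (x y : R) :
    contract r (avg x y) = avg (contract r x) (contract r y) := by
  obtain ⟨hr1, hr2⟩ := hr
  have p1 : 0 ≤ (1 + r) / 2 := by linarith
  have p2 : 0 ≤ (1 - r) / 2 := by linarith
  have h : (0 : ℝ) ≤ 1 / 2 := by norm_num
  simp only [contract, avg]
  rw [comb_star h h (by norm_num), sm_comb ⟨p1, by linarith⟩ h h (by norm_num),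
    sm_comb ⟨p2, by linarith⟩ h h (by norm_num), sm_comb ⟨h, by norm_num⟩ p1 p2 (by linarith),
    sm_comb ⟨h, by norm_num⟩ p1 p2 (by linarith), mul_comm ((1 + r) / 2),
    mul_comm ((1 - r) / 2)]
  ac_rfl

theorem avg_contract {r s : ℝ} (hr : r ∈ Set.Icc (-1 : ℝ) 1) (hs : s ∈ Set.Icc (-1 : ℝ) 1)
    (x : R) : avg (contract r x) (contract s x) = contract ((r + s) / 2) x := by
  obtain ⟨hr1, hr2⟩ := hr
  obtain ⟨hs1, hs2⟩ := hs
  have h : (0 : ℝ) ≤ 1 / 2 := by norm_num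
  simp only [contract, avg]
  rw [sm_comb ⟨h, by norm_num⟩ (by linarith) (by linarith) (by linarith),
    sm_comb ⟨h, by norm_num⟩ (by linarith) (by linarith) (by linarith),
    show (1 + (r + s) / 2) / 2 = 1 / 2 * ((1 + r) / 2) + 1 / 2 * ((1 + s) / 2) by ring,
    show (1 - (r + s) / 2) / 2 = 1 / 2 * ((1 - r) / 2) + 1 / 2 * ((1 - s) / 2) by ring,
    sm_add (by linarith) (by linarith) (by linarith),
    sm_add (by linarith) (by linarith) (by linarith)]
  ac_rfl

theorem avg_comm (x y : R) : avg x y = avg y x := MVAlgebra.oplus_comm _ _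

theorem avg_mono_left {x y : R} (h : x ≤ y) (z : R) : avg x z ≤ avg y z :=
  oplus_le_oplus (sm_mono _ h) le_rfl

theorem avg_mid (x : R) : avg x (sm (1 / 2) one) = contract (1 / 2) x := by
  rw [contract_of_nonneg (by norm_num) (by norm_num), avg,
    sm_sm ⟨by norm_num, by norm_num⟩ ⟨by norm_num, by norm_num⟩]
  norm_num

theorem avg_star_self (x : R) : avg x∗ x = sm (1 / 2) one := by
  rw [avg, ← sm_oplus _ le_rfl, star_oplus_self]

/-- Contracting by `1/2` is averaging with the middle point, so both sides equal `x/4 + y/4 + z/4 +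
1/8`. This becomes associativity of addition in the envelope. -/
theorem avg_assoc (x y z : R) :
    avg (avg x y) (contract (1 / 2) z) = avg (contract (1 / 2) x) (avg y z) := by
  have key : ∀ a b c : R, avg (avg a b) (contract (1 / 2) c) =
      sm (1 / 4) a ⊕ₘ sm (1 / 4) b ⊕ₘ sm (1 / 4) c ⊕ₘ sm (1 / 8) one := by
    intro a b c
    rw [contract_of_nonneg (by norm_num) (by norm_num)]
    simp only [avg]
    rw [sm_comb ⟨by norm_num, by norm_num⟩ (by norm_num) (by norm_num) (by norm_num),
      sm_comb ⟨by norm_num, by norm_num⟩ (by norm_num) (by norm_num) (by norm_num)]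
    norm_num
    ac_rfl
  rw [avg_comm (contract (1 / 2) x), key, key]
  ac_rfl

theorem avg_injective_left (z : R) : Function.Injective fun x : R => avg x z := fun _ _ h =>
  sm_injective (by norm_num) (by norm_num) (oplus_right_cancel
    (sm_le_sm_star (by norm_num) (by norm_num) (by norm_num) _ _)
    (sm_le_sm_star (by norm_num) (by norm_num) (by norm_num) _ _) h)

end Contract

/-! ### The enveloping Riesz space. -/

section Envelope

attribute [local instance] mvLattice

variable (R : Type*) [RieszMVAlgebra R]

theorem mem_Icc_of_Ioc (e : Set.Ioc (0 : ℝ) 1) : (e : ℝ) ∈ Set.Icc (-1 : ℝ) 1 :=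
  ⟨by linarith [e.2.1], e.2.2⟩

variable {R} in
theorem contract_contract_Ioc (e d : Set.Ioc (0 : ℝ) 1) (x : R) :
    contract e (contract d x) = contract ((e * d : Set.Ioc (0 : ℝ) 1) : ℝ) x :=
  contract_contract (mem_Icc_of_Ioc e) (mem_Icc_of_Ioc d) x

/-- Pairs `(x, e)` up to rescaling; the pair `(x, e)` stands for the vector `(x - 1/2) / e`. -/
def envelopeSetoid : Setoid (R × Set.Ioc (0 : ℝ) 1) where
  r a b := contract b.2 a.1 = contract a.2 b.1
  iseqv :=
    { refl := fun _ => rfl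
      symm := fun h => h.symm
      trans := by
        rintro ⟨x, e⟩ ⟨y, d⟩ ⟨z, f⟩ h h'
        -- The middle denominator `d` can be cancelled, as in transitivity for fractions.
        apply contract_injective d.2.1 d.2.2
        dsimp only at h h' ⊢
        rw [contract_contract_Ioc, mul_comm d f, ← contract_contract_Ioc, h,
          contract_contract_Ioc, mul_comm f e, ← contract_contract_Ioc, h',
          contract_contract_Ioc, contract_contract_Ioc, mul_comm] }

/-- The enveloping unital Riesz space of a Riesz MV-algebra. -/
def Envelope : Type _ := Quotient (envelopeSetoid R)

namespace Envelope

variable {R}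

/-- The vector `(x - 1/2) / e`. -/
def mk (x : R) (e : Set.Ioc (0 : ℝ) 1) : Envelope R := Quotient.mk (envelopeSetoid R) (x, e)

theorem mk_eq_mk {x y : R} {e d : Set.Ioc (0 : ℝ) 1} :
    mk x e = mk y d ↔ contract d x = contract e y :=
  Quotient.eq (r := envelopeSetoid R)

theorem mk_inj {x y : R} {e : Set.Ioc (0 : ℝ) 1} : mk x e = mk y e ↔ x = y :=
  mk_eq_mk.trans (contract_injective e.2.1 e.2.2).eq_iff

theorem mk_contract (x : R) (e d : Set.Ioc (0 : ℝ) 1) : mk (contract d x) (e * d) = mk x e := by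
  rw [mk_eq_mk, contract_contract_Ioc]

theorem exists_mk (v : Envelope R) : ∃ x e, v = mk x e := by
  obtain ⟨⟨x, e⟩, rfl⟩ := Quotient.exists_rep v
  exact ⟨x, e, rfl⟩

theorem exists_mk₂ (v w : Envelope R) : ∃ x y e, v = mk x e ∧ w = mk y e := by
  obtain ⟨x, e, rfl⟩ := exists_mk v
  obtain ⟨y, d, rfl⟩ := exists_mk w
  exact ⟨contract d x, contract e y, e * d, (mk_contract x e d).symm,
    by rw [mul_comm, mk_contract]⟩

theorem exists_mk₃ (v w z : Envelope R) :
    ∃ x y t e, v = mk x e ∧ w = mk y e ∧ z = mk t e := by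
  obtain ⟨x, y, e, rfl, rfl⟩ := exists_mk₂ v w
  obtain ⟨t, d, rfl⟩ := exists_mk z
  exact ⟨contract d x, contract d y, contract e t, e * d, (mk_contract x e d).symm,
    (mk_contract y e d).symm, by rw [mul_comm, mk_contract]⟩

/-- Extension to the envelope of a unary operation that commutes with homotheties. -/
def lift₁ (f : R → R) (hf : ∀ (e : Set.Ioc (0 : ℝ) 1) x, contract e (f x) = f (contract e x)) :
    Envelope R → Envelope R :=
  Quotient.map (fun a => (f a.1, a.2)) (by
    rintro ⟨x, e⟩ ⟨y, d⟩ h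
    change contract d (f x) = contract e (f y)
    rw [hf, hf, show contract d x = contract e y from h])

/-- Extension to the envelope of a binary operation that commutes with homotheties. -/
def lift₂ (f : R → R → R)
    (hf : ∀ (e : Set.Ioc (0 : ℝ) 1) x y, contract e (f x y) = f (contract e x) (contract e y)) :
    Envelope R → Envelope R → Envelope R :=
  Quotient.map₂ (fun a b => (f (contract b.2 a.1) (contract a.2 b.1), a.2 * b.2)) (by
    rintro ⟨x, e⟩ ⟨x', e'⟩ h ⟨y, d⟩ ⟨y', d'⟩ h'
    have h : contract e' x = contract e x' := h
    have h' : contract d' y = contract d y' := h'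
    change contract (e' * d' : Set.Ioc (0 : ℝ) 1) (f (contract d x) (contract e y)) =
      contract (e * d : Set.Ioc (0 : ℝ) 1) (f (contract d' x') (contract e' y'))
    have h1 : contract (e' * d' : Set.Ioc (0 : ℝ) 1) (contract d x) =
        contract (e * d : Set.Ioc (0 : ℝ) 1) (contract d' x') := by
      rw [contract_contract_Ioc, contract_contract_Ioc, show e' * d' * d = d' * d * e' by ac_rfl,
        ← contract_contract_Ioc, h, contract_contract_Ioc]
      congr 2
      ac_rfl
    have h2 : contract (e' * d' : Set.Ioc (0 : ℝ) 1) (contract e y) =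
        contract (e * d : Set.Ioc (0 : ℝ) 1) (contract e' y') := by
      rw [contract_contract_Ioc, contract_contract_Ioc, show e' * d' * e = e' * e * d' by ac_rfl,
        ← contract_contract_Ioc, h', contract_contract_Ioc]
      congr 2
      ac_rfl
    rw [hf, hf, h1, h2])

theorem lift₂_mk (f : R → R → R) (hf) (x y : R) (e : Set.Ioc (0 : ℝ) 1) :
    lift₂ f hf (mk x e) (mk y e) = mk (f x y) e := by
  rw [← mk_contract (f x y) e e, hf]
  rfl

/-- Multiplication by the scalar `1 / s ≥ 1`. -/
def dilate (s : Set.Ioc (0 : ℝ) 1) : Envelope R → Envelope R :=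
  Quotient.map (fun a => (a.1, a.2 * s)) (by
    rintro ⟨x, e⟩ ⟨y, d⟩ h
    change contract (d * s : Set.Ioc (0 : ℝ) 1) x = contract (e * s : Set.Ioc (0 : ℝ) 1) y
    rw [mul_comm d, mul_comm e, ← contract_contract_Ioc, ← contract_contract_Ioc,
      show contract d x = contract e y from h])

theorem dilate_mk (s : Set.Ioc (0 : ℝ) 1) (x : R) (e : Set.Ioc (0 : ℝ) 1) :
    dilate s (mk x e) = mk x (e * s) := rfl

/-- The scalar `1 / 2`. -/
def half : Set.Ioc (0 : ℝ) 1 := ⟨1 / 2, by norm_num, by norm_num⟩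

theorem coe_half : (half : ℝ) = 1 / 2 := rfl

/-- The sum is twice the midpoint; doubling only changes the denominator. -/
instance : Add (Envelope R) :=
  ⟨fun v w => dilate half (lift₂ avg (fun e => contract_avg (mem_Icc_of_Ioc e)) v w)⟩

theorem mk_add_mk (x y : R) (e : Set.Ioc (0 : ℝ) 1) : mk x e + mk y e = mk (avg x y) (e * half) := by
  change dilate half (lift₂ _ _ _ _) = _
  rw [lift₂_mk, dilate_mk]

instance : Zero (Envelope R) := ⟨mk (sm (1 / 2) one) 1⟩

theorem mk_mid (e : Set.Ioc (0 : ℝ) 1) : mk (sm (1 / 2) one : R) e = 0 := by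
  change _ = mk _ 1
  rw [mk_eq_mk, contract_mid (mem_Icc_of_Ioc _), contract_mid (mem_Icc_of_Ioc _)]

instance : Neg (Envelope R) :=
  ⟨lift₁ MVAlgebra.star fun e x => contract_star (mem_Icc_of_Ioc e) x⟩

theorem neg_mk (x : R) (e : Set.Ioc (0 : ℝ) 1) : -mk x e = mk x∗ e := rfl

instance : Max (Envelope R) := ⟨lift₂ (· ⊔ ·) fun e => contract_sup e.2.1.le e.2.2⟩

instance : Min (Envelope R) := ⟨lift₂ (· ⊓ ·) fun e => contract_inf e.2.1.le e.2.2⟩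

theorem mk_sup_mk (x y : R) (e : Set.Ioc (0 : ℝ) 1) : mk x e ⊔ mk y e = mk (x ⊔ y) e :=
  lift₂_mk _ _ x y e

theorem mk_inf_mk (x y : R) (e : Set.Ioc (0 : ℝ) 1) : mk x e ⊓ mk y e = mk (x ⊓ y) e :=
  lift₂_mk _ _ x y e

theorem div_mem_Icc {r n : ℝ} (h : |r| ≤ n) : r / n ∈ Set.Icc (-1 : ℝ) 1 := by
  rw [Set.mem_Icc, ← abs_le, abs_div, abs_of_nonneg ((abs_nonneg r).trans h)]
  exact div_le_one_of_le₀ h ((abs_nonneg r).trans h)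

theorem inv_mem_Ioc {n : ℝ} (h : 1 ≤ n) : n⁻¹ ∈ Set.Ioc (0 : ℝ) 1 :=
  ⟨by positivity, inv_le_one_of_one_le₀ h⟩

/-- With `n = max 1 |r|`, the scalar `r` is `r / n`, a homothety ratio in `[-1, 1]`, followed by
dilation by `n`. -/
instance : SMul ℝ (Envelope R) :=
  ⟨fun r v => dilate ⟨(max 1 |r|)⁻¹, inv_mem_Ioc (le_max_left _ _)⟩
    (lift₁ (contract (r / max 1 |r|)) (fun e x => by
      rw [contract_contract (mem_Icc_of_Ioc e) (div_mem_Icc (le_max_right _ _)),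
        contract_contract (div_mem_Icc (le_max_right _ _)) (mem_Icc_of_Ioc e), mul_comm]) v)⟩

/-- Any bound `n` may replace `max 1 |r|`, so several scalars can share one denominator. -/
theorem smul_mk {r n : ℝ} (hn : 1 ≤ n) (hr : |r| ≤ n) (x : R) (e : Set.Ioc (0 : ℝ) 1) :
    r • mk x e = mk (contract (r / n) x) (e * ⟨n⁻¹, inv_mem_Ioc hn⟩) := by
  have hm := inv_mem_Ioc (le_max_left 1 |r|)
  change mk (contract (r / max 1 |r|) x) (e * ⟨(max 1 |r|)⁻¹, hm⟩) = _
  rw [mk_eq_mk, mul_comm e, mul_comm e,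
    contract_contract (mem_Icc_of_Ioc (⟨n⁻¹, inv_mem_Ioc hn⟩ * e))
      (div_mem_Icc (le_max_right _ _)),
    contract_contract (mem_Icc_of_Ioc (⟨_, hm⟩ * e)) (div_mem_Icc hr)]
  congr 1
  simp only [Set.Ioc.coe_mul]
  ring

instance : AddCommGroup (Envelope R) where
  nsmul := nsmulRec
  zsmul := zsmulRec
  add_assoc v w z := by
    obtain ⟨x, y, t, e, rfl, rfl, rfl⟩ := exists_mk₃ v w z
    rw [mk_add_mk, mk_add_mk, ← mk_contract t e half, ← mk_contract x e half, mk_add_mk, mk_add_mk,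
      coe_half, avg_assoc]
  zero_add v := by
    obtain ⟨x, e, rfl⟩ := exists_mk v
    rw [← mk_mid e, mk_add_mk, avg_comm, avg_mid, ← mk_contract x e half, coe_half]
  add_zero v := by
    obtain ⟨x, e, rfl⟩ := exists_mk v
    rw [← mk_mid e, mk_add_mk, avg_mid, ← mk_contract x e half, coe_half]
  neg_add_cancel v := by
    obtain ⟨x, e, rfl⟩ := exists_mk v
    rw [neg_mk, mk_add_mk, avg_star_self, mk_mid]
  add_comm v w := by
    obtain ⟨x, y, e, rfl, rfl⟩ := exists_mk₂ v w
    rw [mk_add_mk, mk_add_mk, avg_comm]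

instance : Module ℝ (Envelope R) := Module.ofMinimalAxioms
  (fun r v w => by
    obtain ⟨x, y, e, rfl, rfl⟩ := exists_mk₂ v w
    have hn := le_max_left 1 |r|
    have hr := le_max_right 1 |r|
    rw [mk_add_mk, smul_mk hn hr, smul_mk hn hr, smul_mk hn hr, mk_add_mk,
      contract_avg (div_mem_Icc hr)]
    congr 1
    ac_rfl)
  (fun r s v => by
    obtain ⟨x, e, rfl⟩ := exists_mk v
    have h0 := abs_nonneg r
    have h1 := abs_nonneg s
    have hn : 1 ≤ 1 + |r| + |s| := by linarith
    have hr : |r| ≤ 1 + |r| + |s| := by linarith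
    have hs : |s| ≤ 1 + |r| + |s| := by linarith
    -- The bound for `r + s` is doubled to match the factor `half` introduced by the sum.
    rw [smul_mk hn hr, smul_mk hn hs, mk_add_mk, avg_contract (div_mem_Icc hr) (div_mem_Icc hs),
      smul_mk (n := 2 * (1 + |r| + |s|)) (by linarith) ((abs_add_le r s).trans (by linarith))]
    congr 1
    · congr 1
      rw [← add_div, div_div, mul_comm 2]
    · ext
      simp only [Set.Ioc.coe_mul, coe_half]
      rw [mul_inv]
      ring)
  (fun r s v => by
    obtain ⟨x, e, rfl⟩ := exists_mk v
    have hr1 := le_max_left 1 |r|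
    have hr := le_max_right 1 |r|
    have hs1 := le_max_left 1 |s|
    have hs := le_max_right 1 |s|
    rw [smul_mk hs1 hs, smul_mk hr1 hr, contract_contract (div_mem_Icc hr) (div_mem_Icc hs),
      smul_mk (n := max 1 |r| * max 1 |s|) (one_le_mul_of_one_le_of_one_le hr1 hs1)
        (by rw [abs_mul]; gcongr)]
    congr 1
    · congr 1
      ring
    · ext
      simp only [Set.Ioc.coe_mul]
      rw [mul_inv]
      ring)
  (fun v => by
    obtain ⟨x, e, rfl⟩ := exists_mk v
    rw [smul_mk (n := 1) le_rfl (by simp)]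
    congr 1
    · simp
    · ext
      simp)

instance : Lattice (Envelope R) := Lattice.mk'
  (fun v w => by
    obtain ⟨x, y, e, rfl, rfl⟩ := exists_mk₂ v w
    rw [mk_sup_mk, mk_sup_mk, sup_comm])
  (fun v w z => by
    obtain ⟨x, y, t, e, rfl, rfl, rfl⟩ := exists_mk₃ v w z
    simp only [mk_sup_mk, sup_assoc])
  (fun v w => by
    obtain ⟨x, y, e, rfl, rfl⟩ := exists_mk₂ v w
    rw [mk_inf_mk, mk_inf_mk, inf_comm])
  (fun v w z => by
    obtain ⟨x, y, t, e, rfl, rfl, rfl⟩ := exists_mk₃ v w z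
    simp only [mk_inf_mk, inf_assoc])
  (fun v w => by
    obtain ⟨x, y, e, rfl, rfl⟩ := exists_mk₂ v w
    rw [mk_inf_mk, mk_sup_mk, sup_inf_self])
  (fun v w => by
    obtain ⟨x, y, e, rfl, rfl⟩ := exists_mk₂ v w
    rw [mk_sup_mk, mk_inf_mk, inf_sup_self])

theorem mk_le_mk {x y : R} {e : Set.Ioc (0 : ℝ) 1} : mk x e ≤ mk y e ↔ x ≤ y := by
  rw [← sup_eq_right, ← sup_eq_right, mk_sup_mk, mk_inj]

instance : IsOrderedAddMonoid (Envelope R) where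
  add_le_add_left v w h z := by
    obtain ⟨x, y, t, e, rfl, rfl, rfl⟩ := exists_mk₃ v w z
    rw [mk_add_mk, mk_add_mk, mk_le_mk]
    exact avg_mono_left (mk_le_mk.1 h) t

instance : PosSMulMono ℝ (Envelope R) where
  smul_le_smul_of_nonneg_left r hr v w h := by
    obtain ⟨x, y, e, rfl, rfl⟩ := exists_mk₂ v w
    have hn := le_max_left 1 |r|
    have hr' := le_max_right 1 |r|
    rw [smul_mk hn hr', smul_mk hn hr', mk_le_mk]
    exact contract_mono (div_nonneg hr (by linarith)) (div_mem_Icc hr').2 (mk_le_mk.1 h)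

/-- The strong unit of the envelope. -/
def unit : Envelope R := mk one half

theorem isStrongUnit_unit : IsStrongUnit (unit : Envelope R) := by
  constructor
  · rw [← mk_mid half, unit, mk_le_mk]
    exact mv_le_one _
  · intro v
    obtain ⟨x, e, rfl⟩ := exists_mk v
    obtain ⟨n, hn⟩ := exists_nat_ge (e : ℝ)⁻¹
    have he := e.2.1
    have hn1 : (1 : ℝ) ≤ n := ((one_le_inv₀ he).2 e.2.2).trans hn
    have hn0 : (0 : ℝ) < n := by linarith
    refine ⟨n, ?_⟩
    -- Contracting by this ratio brings the vector to the denominator of `n • unit`, where the claim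
    -- is just that points of `R` are at most `1`.
    have hd : (n : ℝ)⁻¹ / 2 / e ∈ Set.Ioc (0 : ℝ) 1 := by
      refine ⟨by positivity, ?_⟩
      rw [div_le_one he]
      have : (n : ℝ)⁻¹ ≤ e := inv_le_of_inv_le₀ he hn
      linarith
    rw [← Nat.cast_smul_eq_nsmul ℝ, unit, smul_mk hn1 (by simp), div_self hn0.ne', contract_one,
      ← mk_contract x e ⟨_, hd⟩, show e * ⟨_, hd⟩ = half * ⟨(n : ℝ)⁻¹, inv_mem_Ioc hn1⟩ from ?_,
      mk_le_mk]
    · exact mv_le_one _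
    · ext
      simp only [Set.Ioc.coe_mul, coe_half]
      field_simp

/-! ### Identification of `R` with the unit interval of its envelope. -/

/-- The embedding of a Riesz MV-algebra into its envelope. -/
def of (x : R) : Envelope R := mk (avg x one) half

theorem of_injective : Function.Injective (of : R → Envelope R) := fun _ _ h =>
  avg_injective_left one (mk_inj.1 h)

theorem of_zero : of (MVAlgebra.zero : R) = 0 := by
  rw [of, avg, sm_zero, zero_oplus, mk_mid]

theorem unit_eq : (unit : Envelope R) = mk (contract (1 / 2) one) (half * half) :=
  (mk_contract _ half half).symm

theorem of_eq (x : R) : of x = mk (contract (1 / 2) (avg x one)) (half * half) :=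
  (mk_contract _ half half).symm

theorem contract_half (x : R) : contract (1 / 2) x = sm (1 / 2) x ⊕ₘ sm (1 / 4) one := by
  rw [contract_of_nonneg (by norm_num) (by norm_num)]
  norm_num

theorem avg_avg (x y z t : R) : avg (avg x y) (avg z t) =
    sm (1 / 4) x ⊕ₘ sm (1 / 4) y ⊕ₘ (sm (1 / 4) z ⊕ₘ sm (1 / 4) t) := by
  simp only [avg]
  rw [sm_comb ⟨by norm_num, by norm_num⟩ (by norm_num) (by norm_num) (by norm_num),
    sm_comb ⟨by norm_num, by norm_num⟩ (by norm_num) (by norm_num) (by norm_num)]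
  norm_num

theorem contract_half_avg_one (x : R) :
    contract (1 / 2) (avg x one) = sm (1 / 4) x ⊕ₘ sm (1 / 2) one := by
  rw [contract_half, avg,
    sm_comb ⟨by norm_num, by norm_num⟩ (by norm_num) (by norm_num) (by norm_num),
    MVAlgebra.oplus_assoc, ← sm_add (by norm_num) (by norm_num) (by norm_num)]
  norm_num

theorem quarter_oplus_quarter : (sm (1 / 4) one ⊕ₘ sm (1 / 4) one : R) = sm (1 / 2) one := by
  rw [← sm_add (by norm_num) (by norm_num) (by norm_num)]
  norm_num

/-- Over the denominator `1/4` nothing overflows: the claim is that `x/4 + y/4`, cut at `1/4` and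
shifted by `1/2`, is `(x ⊕ₘ y)/4 + 1/2`, which is `sm_oplus_eq_inf`. -/
theorem of_oplus (x y : R) : of (x ⊕ₘ y) = (of x + of y) ⊓ unit := by
  rw [of_eq, unit_eq, of, of, mk_add_mk, mk_inf_mk, mk_inj, avg_avg, contract_half_avg_one,
    contract_half, sm_oplus_eq_inf, inf_oplus, ← quarter_oplus_quarter]
  congr 1
  · ac_rfl
  · rw [quarter_oplus_quarter, MVAlgebra.oplus_comm]

theorem of_star_add_of (x : R) : of x∗ + of x = unit := by
  rw [unit_eq, of, of, mk_add_mk, mk_inj, avg_avg, contract_half]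
  have h : sm (1 / 4) x∗ ⊕ₘ sm (1 / 4) x = sm (1 / 4) (one : R) := by
    rw [← sm_oplus _ le_rfl, star_oplus_self]
  rw [← quarter_oplus_quarter]
  nth_rewrite 3 [← h]
  ac_rfl

theorem of_star (x : R) : of x∗ = unit - of x := eq_sub_of_add_eq (of_star_add_of x)

theorem of_smul (r : unitInterval) (x : R) : of (r • x) = (r : ℝ) • of x := by
  have h0 : (0 : ℝ) ≤ r := r.2.1
  have h1 : (r : ℝ) ≤ 1 := r.2.2
  rw [of, of, smul_mk (n := 1) le_rfl (by rwa [abs_of_nonneg h0]), div_one,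
    show half * ⟨(1 : ℝ)⁻¹, inv_mem_Ioc le_rfl⟩ = half by ext; simp, mk_inj,
    contract_of_nonneg h0 h1, avg, avg,
    sm_comb ⟨h0, h1⟩ (by norm_num) (by norm_num) (by norm_num), MVAlgebra.oplus_assoc,
    ← sm_add (by linarith) (by linarith) (by linarith), ← sm_coe,
    sm_sm ⟨by norm_num, by norm_num⟩ ⟨h0, h1⟩]
  congr 2 <;> ring

theorem of_mem_Icc (x : R) : of x ∈ Set.Icc (0 : Envelope R) unit := by
  constructor
  · rw [← mk_mid half, of, mk_le_mk, ← zero_oplus (sm (1 / 2) one), ← sm_zero (1 / 2)]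
    exact avg_mono_left (mv_zero_le x) one
  · rw [of, unit, mk_le_mk]
    exact mv_le_one _

theorem exists_of_eq {v : Envelope R} (hv : v ∈ Set.Icc (0 : Envelope R) unit) :
    ∃ x, of x = v := by
  obtain ⟨y, e, rfl⟩ := exists_mk v
  obtain ⟨n, hn⟩ := exists_pow_lt_of_lt_one e.2.1 (by norm_num : (1 / 2 : ℝ) < 1)
  have hq : (0 : ℝ) < (1 / 2) ^ n := by positivity
  have hq1 : (1 / 2 : ℝ) ^ n ≤ 1 := pow_le_one₀ (by norm_num) (by norm_num)
  -- Contracting by this ratio turns the denominator `e` into `2⁻⁽ⁿ⁺¹⁾`, a power of `1/2` as the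
  -- divisibility lemma requires.
  have hd : 1 / 2 * (1 / 2) ^ n / (e : ℝ) ∈ Set.Ioc (0 : ℝ) 1 :=
    ⟨div_pos (by positivity) e.2.1, (div_le_one e.2.1).2 (by linarith)⟩
  obtain ⟨q, hq'⟩ : ∃ q : Set.Ioc (0 : ℝ) 1, (q : ℝ) = (1 / 2) ^ n := ⟨⟨_, hq, hq1⟩, rfl⟩
  have hed : e * ⟨_, hd⟩ = half * q := by
    ext
    simp only [Set.Ioc.coe_mul, coe_half, hq']
    have := e.2.1.ne'
    field_simp
  rw [← mk_contract y e ⟨_, hd⟩, hed] at hv ⊢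
  generalize contract _ y = z at hv ⊢
  rw [← hq'] at hq hq1
  have h1 : sm (1 / 2) one ≤ z := by
    have := hv.1
    rwa [← mk_mid (half * q), mk_le_mk] at this
  have h2 : z ≤ sm ((1 / 2) ^ (n + 1)) one ⊕ₘ sm (1 / 2) one := by
    have := hv.2
    rw [unit, ← mk_contract one half q, mk_le_mk, contract_of_nonneg hq.le hq1,
      ← sm_add hq.le (by linarith) (by linarith)] at this
    rw [pow_succ, ← hq', ← sm_add (by linarith) (by norm_num) (by linarith)]
    convert this using 2
    ring
  -- The new numerator `z` satisfies `1/2 ≤ z ≤ 1/2 + 2⁻⁽ⁿ⁺¹⁾`, so `z - 1/2` is divisible by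
  -- `2⁻⁽ⁿ⁺¹⁾`.
  obtain ⟨x, hx⟩ := exists_sm_half_pow_eq (n + 1) (ominus_le_iff.2 h2)
  refine ⟨x, ?_⟩
  rw [of, ← mk_contract (avg x one) half q, mk_inj, contract_of_nonneg hq.le hq1, avg,
    sm_comb ⟨hq.le, hq1⟩ (by norm_num) (by norm_num) (by norm_num), MVAlgebra.oplus_assoc,
    ← sm_add (by linarith) (by linarith) (by linarith)]
  rw [pow_succ, ← hq'] at hx
  rw [hx, show (q : ℝ) * (1 / 2) + (1 - q) / 2 = 1 / 2 by ring, ominus_oplus_cancel h1]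

end Envelope

end Envelope

/-! ### Essential surjectivity. -/

section EssSurj

/-- The enveloping unital Riesz space as an object of the category of unital Riesz spaces. -/
def envelopeSpace (R : Type w) [RieszMVAlgebra R] : UnitalRieszSpace.{w} where
  carrier := Envelope R
  unit := Envelope.unit
  isStrongUnit := Envelope.isStrongUnit_unit

/-- The canonical morphism from a Riesz MV-algebra to the unit interval of its envelope. -/
def toGammaEnvelope (R : Type w) [RieszMVAlgebra R] :
    RieszMVHom R (GammaR.obj (envelopeSpace R)) where
  toFun x := ⟨Envelope.of x, Envelope.of_mem_Icc x⟩
  map_zero := Subtype.ext Envelope.of_zero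
  map_oplus x y := Subtype.ext (Envelope.of_oplus x y)
  map_star x := Subtype.ext (Envelope.of_star x)
  map_smul r x := Subtype.ext (Envelope.of_smul r x)

theorem toGammaEnvelope_bijective (R : Type w) [RieszMVAlgebra R] :
    Function.Bijective (toGammaEnvelope R).toFun := by
  constructor
  · intro x y h
    exact Envelope.of_injective (congrArg Subtype.val h)
  · rintro ⟨v, hv⟩
    obtain ⟨x, hx⟩ := Envelope.exists_of_eq hv
    exact ⟨x, Subtype.ext hx⟩

/-- The inverse of a bijective morphism of Riesz MV-algebras. -/
def RieszMVHom.symmOfBijective {R S : Type*} [RieszMVAlgebra R] [RieszMVAlgebra S]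
    (f : RieszMVHom R S) (hf : Function.Bijective f.toFun) : RieszMVHom S R where
  toFun := (Equiv.ofBijective _ hf).symm
  map_zero := by
    rw [Equiv.symm_apply_eq]
    exact f.map_zero.symm
  map_oplus x y := by
    rw [Equiv.symm_apply_eq]
    refine Eq.trans ?_ (f.map_oplus _ _).symm
    exact congrArg₂ _ ((Equiv.ofBijective _ hf).apply_symm_apply x).symm
      ((Equiv.ofBijective _ hf).apply_symm_apply y).symm
  map_star x := by
    rw [Equiv.symm_apply_eq]
    refine Eq.trans ?_ (f.map_star _).symm
    exact congrArg _ ((Equiv.ofBijective _ hf).apply_symm_apply x).symm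
  map_smul r x := by
    rw [Equiv.symm_apply_eq]
    refine Eq.trans ?_ (f.map_smul _ _).symm
    exact congrArg _ ((Equiv.ofBijective _ hf).apply_symm_apply x).symm

/-- A bijective morphism of Riesz MV-algebras is an isomorphism. -/
def isoOfBijective {R S : RieszMVCat.{w}} (f : RieszMVHom R S)
    (hf : Function.Bijective f.toFun) : R ≅ S where
  hom := f
  inv := f.symmOfBijective hf
  hom_inv_id := RieszMVHom.ext (funext (Equiv.ofBijective _ hf).symm_apply_apply)
  inv_hom_id := RieszMVHom.ext (funext (Equiv.ofBijective _ hf).apply_symm_apply)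

instance : (GammaR : UnitalRieszSpace.{w} ⥤ RieszMVCat.{w}).EssSurj where
  mem_essImage R :=
    ⟨envelopeSpace R, ⟨(isoOfBijective (R := R) (toGammaEnvelope R)
      (toGammaEnvelope_bijective R)).symm⟩⟩

end EssSurj

/-! ### Rescaling vectors of a unital Riesz space into `[0, u]`. -/

section Normalize

variable {V : UnitalRieszSpace.{w}}

/-- The vector `v` lies between `-t u` and `t u`. -/
def BoundedBy (t : ℝ) (v : V) : Prop := 0 < t ∧ -(t • V.unit) ≤ v ∧ v ≤ t • V.unit

/-- The affine map taking `[-t u, t u]` onto `[0, u]`. -/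
def normalize (t : ℝ) (v : V) : V := (2 * t)⁻¹ • (v + t • V.unit)

theorem unit_nonneg : 0 ≤ V.unit := V.isStrongUnit.1

theorem smul_unit_mono {s t : ℝ} (h : s ≤ t) : s • V.unit ≤ t • V.unit := by
  rw [← sub_nonneg, ← sub_smul]
  exact smul_nonneg (sub_nonneg.2 h) unit_nonneg

theorem BoundedBy.mono {s t : ℝ} {v : V} (hv : BoundedBy s v) (h : s ≤ t) : BoundedBy t v :=
  ⟨hv.1.trans_le h, (neg_le_neg (smul_unit_mono h)).trans hv.2.1,
    hv.2.2.trans (smul_unit_mono h)⟩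

theorem exists_boundedBy (v : V) : ∃ t : ℝ, BoundedBy t v := by
  obtain ⟨m, hm⟩ := V.isStrongUnit.2 v
  obtain ⟨n, hn⟩ := V.isStrongUnit.2 (-v)
  rw [← Nat.cast_smul_eq_nsmul ℝ] at hm hn
  have hm0 : (0 : ℝ) ≤ m := m.cast_nonneg
  have hn0 : (0 : ℝ) ≤ n := n.cast_nonneg
  exact ⟨m + n + 1, by linarith, neg_le.1 (hn.trans (smul_unit_mono (by linarith))),
    hm.trans (smul_unit_mono (by linarith))⟩

theorem exists_boundedBy₂ (v v' : V) : ∃ t : ℝ, BoundedBy t v ∧ BoundedBy t v' := by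
  obtain ⟨t, ht⟩ := exists_boundedBy v
  obtain ⟨t', ht'⟩ := exists_boundedBy v'
  exact ⟨max t t', ht.mono (le_max_left _ _), ht'.mono (le_max_right _ _)⟩

theorem BoundedBy.add {t : ℝ} {v v' : V} (h : BoundedBy t v) (h' : BoundedBy t v') :
    BoundedBy (2 * t) (v + v') := by
  refine ⟨by linarith [h.1], ?_, ?_⟩
  · rw [two_mul, add_smul, neg_add]
    exact add_le_add h.2.1 h'.2.1
  · rw [two_mul, add_smul]
    exact add_le_add h.2.2 h'.2.2

theorem BoundedBy.smul {t r : ℝ} {v : V} (h : BoundedBy t v) (hr : 0 < r) :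
    BoundedBy (r * t) (r • v) := by
  refine ⟨mul_pos hr h.1, ?_, ?_⟩
  · rw [mul_smul, ← smul_neg]
    exact smul_le_smul_of_nonneg_left h.2.1 hr.le
  · rw [mul_smul]
    exact smul_le_smul_of_nonneg_left h.2.2 hr.le

theorem BoundedBy.sup {t : ℝ} {v v' : V} (h : BoundedBy t v) (h' : BoundedBy t v') :
    BoundedBy t (v ⊔ v') :=
  ⟨h.1, h.2.1.trans le_sup_left, sup_le h.2.2 h'.2.2⟩

theorem normalize_mem {t : ℝ} {v : V} (h : BoundedBy t v) :
    normalize t v ∈ Set.Icc (0 : V) V.unit := by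
  have ht := h.1
  constructor
  · exact smul_nonneg (by positivity) (neg_le_iff_add_nonneg.1 h.2.1)
  · have h1 : v + t • V.unit ≤ (2 * t) • V.unit := by
      rw [two_mul, add_smul]
      exact add_le_add_left h.2.2 _
    have h2 := smul_le_smul_of_nonneg_left h1 (by positivity : 0 ≤ (2 * t)⁻¹)
    rwa [smul_smul, inv_mul_cancel₀ (by positivity), one_smul] at h2

theorem eq_normalize {t : ℝ} (ht : 0 < t) (v : V) :
    v = (2 * t) • normalize t v - t • V.unit := by
  rw [normalize, smul_smul, mul_inv_cancel₀ (by positivity), one_smul, add_sub_cancel_right]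

theorem smul_sup_of_pos {r : ℝ} (hr : 0 < r) (x y : V) : r • (x ⊔ y) = r • x ⊔ r • y :=
  (OrderIso.smulRight hr).map_sup x y

theorem normalize_sup {t : ℝ} (ht : 0 < t) (v v' : V) :
    normalize t (v ⊔ v') = normalize t v ⊔ normalize t v' := by
  rw [normalize, sup_add, smul_sup_of_pos (by positivity)]
  rfl

theorem normalize_add {t : ℝ} (ht : 0 < t) (v v' : V) : normalize (2 * t) (v + v') =
    (1 / 2 : ℝ) • normalize t v + (1 / 2 : ℝ) • normalize t v' := by
  simp only [normalize]
  match_scalars <;> field_simp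
  norm_num

theorem normalize_smul {t r : ℝ} (ht : 0 < t) (hr : 0 < r) (v : V) :
    normalize (r * t) (r • v) = normalize t v := by
  simp only [normalize]
  match_scalars <;> field_simp

/-- For `t ≤ s` both coefficients lie in `[0,1]`, so a morphism of intervals can be applied to each
term. -/
theorem normalize_eq {s t : ℝ} (ht : 0 < t) (hs : 0 < s) (v : V) :
    normalize s v = (t / s) • normalize t v + ((s - t) / (2 * s)) • V.unit := by
  simp only [normalize]
  match_scalars <;> field_simp
  ring

end Normalize

/-! ### Faithfulness, and extension of interval morphisms to linear maps. -/

section FullyFaithful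

variable {V W : UnitalRieszSpace.{w}}

instance : (GammaR : UnitalRieszSpace.{w} ⥤ RieszMVCat.{w}).Faithful where
  map_injective {V W} f g h := by
    have key : ∀ x : V, x ∈ Set.Icc (0 : V) V.unit → f.toFun x = g.toFun x := fun x hx =>
      congrArg Subtype.val (congrFun (congrArg RieszMVHom.toFun h) ⟨x, hx⟩)
    apply UnitalRieszHom.ext
    funext v
    obtain ⟨t, ht⟩ := exists_boundedBy v
    change f.toLinearMap v = g.toLinearMap v
    rw [eq_normalize ht.1 v, map_sub, map_sub, map_smul, map_smul, map_smul, map_smul]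
    congr 2
    · exact key _ (normalize_mem ht)
    · exact key _ ⟨unit_nonneg, le_rfl⟩

open Classical in
/-- A morphism between unit intervals, extended by zero. -/
def extendZero (h : GammaR.obj V ⟶ GammaR.obj W) (x : V) : W :=
  if hx : x ∈ Set.Icc (0 : V) V.unit then (h.toFun ⟨x, hx⟩).1 else 0

variable (h : GammaR.obj V ⟶ GammaR.obj W)

theorem extendZero_of_mem {x : V} (hx : x ∈ Set.Icc (0 : V) V.unit) :
    extendZero h x = (h.toFun ⟨x, hx⟩).1 := dif_pos hx

theorem extendZero_mem {x : V} (hx : x ∈ Set.Icc (0 : V) V.unit) :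
    extendZero h x ∈ Set.Icc (0 : W) W.unit := by
  rw [extendZero_of_mem h hx]
  exact (h.toFun ⟨x, hx⟩).2

theorem extendZero_oplus {x y : V} (hx : x ∈ Set.Icc (0 : V) V.unit)
    (hy : y ∈ Set.Icc (0 : V) V.unit) :
    extendZero h ((x + y) ⊓ V.unit) = (extendZero h x + extendZero h y) ⊓ W.unit := by
  rw [extendZero_of_mem h hx, extendZero_of_mem h hy,
    extendZero_of_mem h ⟨le_inf (add_nonneg hx.1 hy.1) unit_nonneg, inf_le_right⟩]
  exact congrArg Subtype.val (h.map_oplus ⟨x, hx⟩ ⟨y, hy⟩)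

theorem extendZero_star {x : V} (hx : x ∈ Set.Icc (0 : V) V.unit) :
    extendZero h (V.unit - x) = W.unit - extendZero h x := by
  rw [extendZero_of_mem h hx,
    extendZero_of_mem h ⟨sub_nonneg.2 hx.2, sub_le_self _ hx.1⟩]
  exact congrArg Subtype.val (h.map_star ⟨x, hx⟩)

theorem smul_mem_Icc {r : ℝ} (hr : r ∈ Set.Icc (0 : ℝ) 1) {x : V}
    (hx : x ∈ Set.Icc (0 : V) V.unit) : r • x ∈ Set.Icc (0 : V) V.unit :=
  letI := intervalRieszMV V.unit V.isStrongUnit.1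
  ((⟨r, hr⟩ : unitInterval) • (⟨x, hx⟩ : Set.Icc (0 : V) V.unit)).2

theorem extendZero_smul {r : ℝ} (hr : r ∈ Set.Icc (0 : ℝ) 1) {x : V}
    (hx : x ∈ Set.Icc (0 : V) V.unit) : extendZero h (r • x) = r • extendZero h x := by
  rw [extendZero_of_mem h hx, extendZero_of_mem h (smul_mem_Icc hr hx)]
  exact congrArg Subtype.val (h.map_smul ⟨r, hr⟩ ⟨x, hx⟩)

theorem extendZero_zero : extendZero h 0 = 0 := by
  rw [extendZero_of_mem h ⟨le_rfl, unit_nonneg⟩]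
  exact congrArg Subtype.val h.map_zero

theorem extendZero_unit : extendZero h V.unit = W.unit := by
  have := extendZero_star h (x := 0) ⟨le_rfl, unit_nonneg⟩
  rwa [sub_zero, extendZero_zero, sub_zero] at this

theorem extendZero_mono {x y : V} (hx : x ∈ Set.Icc (0 : V) V.unit)
    (hy : y ∈ Set.Icc (0 : V) V.unit) (hxy : x ≤ y) : extendZero h x ≤ extendZero h y := by
  have hs : y - x ∈ Set.Icc (0 : V) V.unit :=
    ⟨sub_nonneg.2 hxy, (sub_le_self _ hx.1).trans hy.2⟩
  have := extendZero_oplus h hx hs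
  rw [add_sub_cancel, inf_eq_left.2 hy.2] at this
  rw [this]
  exact le_inf (le_add_of_nonneg_right (extendZero_mem h hs).1) (extendZero_mem h hx).2

/-- Monotonicity applied to `x ≤ u - y` shows that the sum of the images is not truncated either. -/
theorem extendZero_add {x y : V} (hx : x ∈ Set.Icc (0 : V) V.unit)
    (hy : y ∈ Set.Icc (0 : V) V.unit) (hxy : x + y ≤ V.unit) :
    extendZero h (x + y) = extendZero h x + extendZero h y := by
  have h1 := extendZero_oplus h hx hy
  rw [inf_eq_left.2 hxy] at h1
  have h2 := extendZero_mono h hx ⟨sub_nonneg.2 hy.2, sub_le_self _ hy.1⟩ (le_sub_iff_add_le.2 hxy)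
  rw [extendZero_star h hy, le_sub_iff_add_le] at h2
  rwa [inf_eq_left.2 h2] at h1

theorem extendZero_ominus {x y : V} (hx : x ∈ Set.Icc (0 : V) V.unit)
    (hy : y ∈ Set.Icc (0 : V) V.unit) :
    extendZero h ((x - y) ⊔ 0) = (extendZero h x - extendZero h y) ⊔ 0 := by
  have key : ∀ {U : UnitalRieszSpace.{w}} (a b : U),
      (a - b) ⊔ 0 = U.unit - (U.unit - a + b) ⊓ U.unit := by
    intro U a b
    rw [sub_inf, sub_self]
    congr 1
    abel
  have hx' : V.unit - x ∈ Set.Icc (0 : V) V.unit := ⟨sub_nonneg.2 hx.2, sub_le_self _ hx.1⟩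
  rw [key, key, extendZero_star h
    ⟨le_inf (add_nonneg hx'.1 hy.1) unit_nonneg, inf_le_right⟩, extendZero_oplus h hx' hy,
    extendZero_star h hx]

/-- Uses `x ⊔ y = (x - y) ⊔ 0 + y`, a sum that stays below the unit. -/
theorem extendZero_sup {x y : V} (hx : x ∈ Set.Icc (0 : V) V.unit)
    (hy : y ∈ Set.Icc (0 : V) V.unit) :
    extendZero h (x ⊔ y) = extendZero h x ⊔ extendZero h y := by
  have e : ∀ {U : UnitalRieszSpace.{w}} (a b : U), (a - b) ⊔ 0 + b = a ⊔ b := by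
    intro U a b
    rw [sup_add, sub_add_cancel, zero_add]
  rw [← e x y, extendZero_add h _ hy, extendZero_ominus h hx hy, e]
  · rw [e]
    exact sup_le hx.2 hy.2
  · exact ⟨le_sup_right, sup_le ((sub_le_self _ hy.1).trans hx.2) unit_nonneg⟩

/-- The value of the linear extension of `h`, computed at scale `t`. -/
def extendAt (t : ℝ) (v : V) : W := (2 * t) • extendZero h (normalize t v) - t • W.unit

theorem extendAt_eq_of_le {s t : ℝ} {v : V} (hv : BoundedBy t v) (hts : t ≤ s) :
    extendAt h s v = extendAt h t v := by
  have ht := hv.1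
  have hs : 0 < s := ht.trans_le hts
  have h1 : t / s ∈ Set.Icc (0 : ℝ) 1 := ⟨by positivity, (div_le_one hs).2 hts⟩
  have h2 : (s - t) / (2 * s) ∈ Set.Icc (0 : ℝ) 1 :=
    ⟨div_nonneg (by linarith) (by linarith), (div_le_one (by linarith)).2 (by linarith)⟩
  have hu : V.unit ∈ Set.Icc (0 : V) V.unit := ⟨unit_nonneg, le_rfl⟩
  have hn := normalize_mem hv
  have hle := (normalize_mem (hv.mono hts)).2
  rw [extendAt, extendAt]
  rw [normalize_eq ht hs v] at hle ⊢
  rw [extendZero_add h (smul_mem_Icc h1 hn) (smul_mem_Icc h2 hu) hle, extendZero_smul h h1 hn,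
    extendZero_smul h h2 hu, extendZero_unit]
  match_scalars <;> field_simp
  ring

/-- The extension of `h` to the whole space. -/
def extend (v : V) : W := extendAt h (exists_boundedBy v).choose v

theorem extend_eq {t : ℝ} {v : V} (hv : BoundedBy t v) : extend h v = extendAt h t v := by
  have hc := (exists_boundedBy v).choose_spec
  -- The chosen scale and `t` are compared through their maximum.
  rw [extend, ← extendAt_eq_of_le h hc (le_max_left _ t),
    ← extendAt_eq_of_le h hv (le_max_right _ t)]

theorem extend_add (v v' : V) : extend h (v + v') = extend h v + extend h v' := by
  obtain ⟨t, hv, hv'⟩ := exists_boundedBy₂ v v'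
  have hh : (1 / 2 : ℝ) ∈ Set.Icc (0 : ℝ) 1 := ⟨by norm_num, by norm_num⟩
  have hle := (normalize_mem (hv.add hv')).2
  rw [extend_eq h hv, extend_eq h hv', extend_eq h (hv.add hv')]
  simp only [extendAt]
  rw [normalize_add hv.1] at hle ⊢
  rw [extendZero_add h (smul_mem_Icc hh (normalize_mem hv)) (smul_mem_Icc hh (normalize_mem hv'))
    hle, extendZero_smul h hh (normalize_mem hv), extendZero_smul h hh (normalize_mem hv')]
  module

theorem extend_zero : extend h 0 = 0 := by
  simpa using extend_add h 0 0

theorem extend_neg (v : V) : extend h (-v) = -extend h v := by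
  rw [eq_neg_iff_add_eq_zero, ← extend_add, neg_add_cancel, extend_zero]

theorem extend_smul_of_pos {r : ℝ} (hr : 0 < r) (v : V) :
    extend h (r • v) = r • extend h v := by
  obtain ⟨t, hv⟩ := exists_boundedBy v
  rw [extend_eq h hv, extend_eq h (hv.smul hr), extendAt, extendAt, normalize_smul hv.1 hr]
  module

theorem extend_smul (r : ℝ) (v : V) : extend h (r • v) = r • extend h v := by
  rcases lt_trichotomy r 0 with hr | rfl | hr
  · have := extend_smul_of_pos h (neg_pos.2 hr) v
    rwa [neg_smul, neg_smul, extend_neg, neg_inj] at this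
  · rw [zero_smul, zero_smul, extend_zero]
  · exact extend_smul_of_pos h hr v

theorem extend_sup (v v' : V) : extend h (v ⊔ v') = extend h v ⊔ extend h v' := by
  obtain ⟨t, hv, hv'⟩ := exists_boundedBy₂ v v'
  rw [extend_eq h hv, extend_eq h hv', extend_eq h (hv.sup hv')]
  simp only [extendAt]
  rw [normalize_sup hv.1, extendZero_sup h (normalize_mem hv) (normalize_mem hv'),
    smul_sup_of_pos (by linarith [hv.1]), sub_eq_add_neg, sup_add, ← sub_eq_add_neg,
    ← sub_eq_add_neg]

theorem extend_inf (v v' : V) : extend h (v ⊓ v') = extend h v ⊓ extend h v' := by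
  rw [← neg_neg (v ⊓ v'), extend_neg, neg_inf, extend_sup, extend_neg, extend_neg, neg_sup,
    neg_neg, neg_neg]

theorem extend_of_mem {x : V} (hx : x ∈ Set.Icc (0 : V) V.unit) :
    extend h x = extendZero h x := by
  have hb : BoundedBy 1 x := by
    refine ⟨one_pos, ?_, ?_⟩ <;> rw [one_smul]
    · exact (neg_nonpos.2 unit_nonneg).trans hx.1
    · exact hx.2
  have hh : (1 / 2 : ℝ) ∈ Set.Icc (0 : ℝ) 1 := ⟨by norm_num, by norm_num⟩
  have hu : V.unit ∈ Set.Icc (0 : V) V.unit := ⟨unit_nonneg, le_rfl⟩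
  have hle := (normalize_mem hb).2
  have e : normalize 1 x = (1 / 2 : ℝ) • x + (1 / 2 : ℝ) • V.unit := by
    rw [normalize]
    module
  rw [extend_eq h hb, extendAt]
  rw [e] at hle ⊢
  rw [extendZero_add h (smul_mem_Icc hh hx) (smul_mem_Icc hh hu) hle, extendZero_smul h hh hx,
    extendZero_smul h hh hu, extendZero_unit]
  module

/-- The morphism of unital Riesz spaces extending a morphism between unit intervals. -/
def extendHom : V ⟶ W :=
  show UnitalRieszHom V W from
  { toFun := extend h
    map_add' := extend_add h
    map_smul' := extend_smul h
    map_sup := extend_sup h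
    map_inf := extend_inf h
    map_unit := (extend_of_mem h ⟨unit_nonneg, le_rfl⟩).trans (extendZero_unit h) }

instance : (GammaR : UnitalRieszSpace.{w} ⥤ RieszMVCat.{w}).Full where
  map_surjective h := ⟨extendHom h, RieszMVHom.ext (funext fun x => Subtype.ext
    ((extend_of_mem h x.2).trans (extendZero_of_mem h x.2)))⟩

end FullyFaithful

end RieszMV

end

theorem theorem4p2 :
    (RieszMV.GammaR : RieszMV.UnitalRieszSpace.{w} ⥤ RieszMV.RieszMVCat.{w}).IsEquivalence ∧
    ∀ (R : Type w) [RieszMV.RieszMVAlgebra R],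
      ∃ (V : RieszMV.UnitalRieszSpace.{w}) (f : RieszMV.RieszMVHom R (RieszMV.GammaR.obj V)),
        Function.Bijective f.toFun :=
  -- The fields of `{}` are filled by the `Faithful`, `Full` and `EssSurj` instances.
  ⟨{}, fun R _ => ⟨RieszMV.envelopeSpace R, RieszMV.toGammaEnvelope R,
    RieszMV.toGammaEnvelope_bijective R⟩⟩
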